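/- Let $K$ be a commutative ring of coefficients of one of the following two kinds, and let $\Phi(u,v)=\sum_{m,n\ge 0}c_{mn}u^mv^n\in K[[u,v]]$ be a double power series: (a) $K$ is a complete normed commutative $\mathbb{Q}$-algebra (for example $\mathbb{R}$ or $\mathbb{C}$), and $\Phi$ is arbitrary; or (b) $K$ is any commutative $\mathbb{Q}$-algebra, and $\Phi(0,0)=c_{00}=0$. For a power series $f(z)=a+g(z)$ with $a\in K$ and $g(0)=0$ put $\exp(f)=e^{a}\sum_{n\ge 0}g(z)^n/n!$, where $e^a=\sum_{n\ge0} a^n/n!$ is the convergent sum in $K$ in case (a), while in case (b) only $a=0$, $e^0=1$ occurs. For a power series $F(t,z)$ with constant term $1$ put $\log F=\sum_{n\ge 1}(-1)^{n+1}(F-1)^n/n$. Then there is a power series $\Psi(u,v)\in K[[u,v]]$ such that, in $K[[t,z]]$, $$\log\left(\sum_{k=0}^{\infty}\frac{t^k}{k!}\exp\bigl(k\,\Phi(kz,z)\bigr)\right)=t\,\Psi(tz,z).$$ Equivalently, the left side has the form $\sum_{n\ge 0}t^{n+1}\theta_n(z)$, where each $\theta_n(z)\in K[[z]]$ contains no power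 of $z$ with exponent less than $n$. -/

import Mathlib

/-! Formal power series used in the statement. In `MvPowerSeries (Fin 2) K` the two variables
are `(u, v)` for `Φ` and `Ψ`, and `(t, z)` for the identity itself. In `PowerSeries K` the
variable is `z`. -/

namespace BouwkampDeBruijn

noncomputable section

open PowerSeries (C X)
open scoped Nat

/-- The power series `k Φ(k z, z)` in `z`. -/
def exponent {K : Type*} [CommRing K] (Φ : MvPowerSeries (Fin 2) K) (k : ℕ) : PowerSeries K :=
  (k : K) • (MvPowerSeries.subst (![(k : K) • X, X] : Fin 2 → PowerSeries K) Φ : PowerSeries K)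

/-- The formal exponential `∑ fⁿ / n!` of a power series `f` in `z` whose constant term is `0`. -/
def formalExp {K : Type*} [CommRing K] [Algebra ℚ K] (f : PowerSeries K) : PowerSeries K :=
  (PowerSeries.exp K).subst f

/-- The exponential of an arbitrary power series `f = a + g`, with `a` constant and `g` without
constant term, over a normed ring: `exp f = exp a * ∑ gⁿ / n!`, where `exp a` is the sum of the
convergent exponential series in `K`. -/
def analyticExp {K : Type*} [NormedCommRing K] [NormedAlgebra ℚ K] (f : PowerSeries K) :
    PowerSeries K :=
  C (NormedSpace.exp (PowerSeries.constantCoeff f)) *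
    formalExp (f - C (PowerSeries.constantCoeff f))

/-- The series `∑ₖ tᵏ / k! * A k (z)` in `t` and `z`: the coefficient of `tᵏ zʲ` is the
coefficient of `zʲ` in `A k`, divided by `k!`. -/
def expGenFun {K : Type*} [CommRing K] [Algebra ℚ K] (A : ℕ → PowerSeries K) :
    MvPowerSeries (Fin 2) K :=
  fun d ↦ (1 / ((d 0)! : ℚ)) • PowerSeries.coeff (d 1) (A (d 0))

/-- The formal logarithm `∑_{n ≥ 1} (-1)ⁿ⁺¹ (F - 1)ⁿ / n` of a series `F` in `t` and `z` with
constant term `1`. -/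
def formalLog {K : Type*} [CommRing K] [Algebra ℚ K] (F : MvPowerSeries (Fin 2) K) :
    MvPowerSeries (Fin 2) K :=
  (PowerSeries.log K).subst (F - 1)

/-- The series `t Ψ(t z, z)` in `t` and `z`. -/
def tPsi {K : Type*} [CommRing K] (Ψ : MvPowerSeries (Fin 2) K) : MvPowerSeries (Fin 2) K :=
  MvPowerSeries.X 0 * MvPowerSeries.subst
    (![MvPowerSeries.X 0 * MvPowerSeries.X 1, MvPowerSeries.X 1] :
      Fin 2 → MvPowerSeries (Fin 2) K) Ψ

/-- The coefficient of `tⁱ zʲ` in a series in `t` and `z`. -/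
def coeffTZ {K : Type*} [CommRing K] (i j : ℕ) (F : MvPowerSeries (Fin 2) K) : K :=
  MvPowerSeries.coeff (Finsupp.single 0 i + Finsupp.single 1 j) F

end

end BouwkampDeBruijn

open BouwkampDeBruijn

/-! Write `F = ∑ tᵏ/k! A k`, `L = log F`, `θ_t = t∂/∂t`, `θ_z = z∂/∂z`. As `θ_t` multiplies the `tᵏ`
term by `k`, logarithmic differentiation of `A k = exp(k Φ(kz, z))` gives `θ_z F = ∑ (m+n) c_{mn}
z^{m+n} θ_t^{m+1} F`. Division by `F` turns this into `θ_z L = ∑ (m+n) c_{mn} z^{m+n} P_{m+1}`,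
where `P_r = F⁻¹ θ_t^r F` is a polynomial in `θ_t L, θ_t² L, …`. Induction on the `z`-degree `J`
bounds the `t`-degree of `L` by `J + 1`. If the bound holds below `J`, each `P_r` has excess at most
`r` there (`excessLE_conjEuler`). Terms with `m+n = 0` vanish; the others use only `z`-degrees below
`J`, and `z^{m+n}` offsets the excess `m+1` up to `1` (`coeff_truncatedFlow_eq_zero`). Modulo `z`,
`F = e^{wt}` and `L = wt`. -/

namespace BouwkampDeBruijn

noncomputable section

open scoped Nat
open MvPowerSeries (coeff constantCoeff)

/-! ### Euler derivations and the chain rule -/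

section Euler

variable {σ K : Type*} [CommRing K]

/-- The Euler derivation `X s * ∂ / ∂ X s` on power series. -/
def euler (s : σ) : Derivation K (MvPowerSeries σ K) (MvPowerSeries σ K) :=
  (MvPowerSeries.X s : MvPowerSeries σ K) • MvPowerSeries.pderiv K s

theorem coeff_euler (s : σ) (f : MvPowerSeries σ K) (d : σ →₀ ℕ) :
    coeff d (euler s f) = (d s : K) * coeff d f := by
  classical
  have h : euler s f = MvPowerSeries.X s * MvPowerSeries.pderiv K s f := rfl
  rw [h, MvPowerSeries.X, MvPowerSeries.coeff_monomial_mul]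
  split_ifs with hd
  · have h1 : 1 ≤ d s := by simpa using hd s
    rw [MvPowerSeries.coeff_pderiv, tsub_add_cancel_of_le hd, one_mul, mul_comm]
    congr 1
    simp [Nat.cast_sub h1]
  · have h1 : d s = 0 := by
      by_contra h0
      exact hd (Finsupp.single_le_iff.2 (Nat.one_le_iff_ne_zero.2 h0))
    simp [h1]

theorem coeff_iterate_euler (s : σ) (f : MvPowerSeries σ K) (r : ℕ) (d : σ →₀ ℕ) :
    coeff d ((euler s)^[r] f) = (d s : K) ^ r * coeff d f := by
  induction r with
  | zero => simp
  | succ r ih => rw [Function.iterate_succ_apply', coeff_euler, ih, pow_succ']; ring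

theorem coeff_pow_mul_eq_zero {a : MvPowerSeries σ K} (ha : constantCoeff a = 0) {n : ℕ}
    (g : MvPowerSeries σ K) {d : σ →₀ ℕ} (hd : d.degree < n) : coeff d (a ^ n * g) = 0 := by
  apply MvPowerSeries.coeff_of_lt_order
  calc (d.degree : ℕ∞) < n := by exact_mod_cast hd
    _ ≤ (a ^ n).order := MvPowerSeries.le_order_pow_of_constantCoeff_eq_zero n ha
    _ ≤ (a ^ n).order + g.order := le_self_add
    _ ≤ _ := MvPowerSeries.le_order_mul

/-- The chain rule for substitution of a multivariate series into a univariate one. -/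
theorem derivation_subst (D : Derivation K (MvPowerSeries σ K) (MvPowerSeries σ K))
    {a : MvPowerSeries σ K} (ha : constantCoeff a = 0) (f : PowerSeries K) :
    D (f.subst a) = (PowerSeries.derivative K f).subst a * D a := by
  have hs : PowerSeries.HasSubst a := PowerSeries.HasSubst.of_constantCoeff_zero ha
  -- No continuity of `D` is assumed: the rule holds for the truncations of `f`, which are
  -- polynomials, and the error is divisible by every power of `a`.
  have key : ∀ n : ℕ, ∃ g, D (f.subst a) - (PowerSeries.derivative K f).subst a * D a
      = a ^ n * g := by
    intro n
    obtain ⟨h, hh⟩ : (PowerSeries.X : PowerSeries K) ^ (n + 1) ∣ f - (f.trunc (n + 1) : PowerSeries K) := by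
      rw [PowerSeries.X_pow_dvd_iff]
      intro m hm
      rw [map_sub, PowerSeries.coeff_coe_trunc_of_lt hm, sub_self]
    set p := f.trunc (n + 1)
    have hf : f = (p : PowerSeries K) + PowerSeries.X ^ (n + 1) * h := by
      rw [← hh, add_sub_cancel]
    have hp : D ((p : PowerSeries K).subst a)
        = (PowerSeries.derivative K (p : PowerSeries K)).subst a * D a := by
      rw [PowerSeries.subst_coe hs, PowerSeries.derivative_coe, PowerSeries.subst_coe hs,
        Derivation.map_aeval, smul_eq_mul]
    have hX : (PowerSeries.X ^ (n + 1) * h).subst a = a ^ (n + 1) * h.subst a := by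
      rw [PowerSeries.subst_mul hs, PowerSeries.subst_pow hs, PowerSeries.subst_X hs]
    have hX' : (PowerSeries.derivative K (PowerSeries.X ^ (n + 1) * h)).subst a
        = a ^ (n + 1) * (PowerSeries.derivative K h).subst a
          + h.subst a * ((n + 1 : ℕ) * a ^ n) := by
      rw [Derivation.leibniz, Derivation.leibniz_pow, PowerSeries.derivative_X, smul_eq_mul,
        smul_eq_mul, PowerSeries.subst_add hs, PowerSeries.subst_mul hs, PowerSeries.subst_mul hs,
        PowerSeries.subst_pow hs, PowerSeries.subst_X hs, Nat.add_sub_cancel,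
        ← PowerSeries.coe_substAlgHom hs]
      simp [PowerSeries.substAlgHom_X]
    refine ⟨a * D (h.subst a) - a * (PowerSeries.derivative K h).subst a * D a, ?_⟩
    rw [hf, PowerSeries.subst_add hs, map_add, map_add, PowerSeries.subst_add hs, hp, hX, hX',
      Derivation.leibniz, Derivation.leibniz_pow]
    simp only [smul_eq_mul, nsmul_eq_mul, Nat.add_sub_cancel]
    ring
  rw [← sub_eq_zero]
  ext d
  obtain ⟨g, hg⟩ := key (d.degree + 1)
  rw [hg, coeff_pow_mul_eq_zero ha g (Nat.lt_succ_self _), map_zero]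

end Euler

/-! ### Derivatives and divisibility of the formal logarithm -/

section Log

variable {K : Type*} [CommRing K] [Algebra ℚ K]

theorem derivation_formalLog_mul
    (D : Derivation K (MvPowerSeries (Fin 2) K) (MvPowerSeries (Fin 2) K))
    {F : MvPowerSeries (Fin 2) K} (hF : constantCoeff F = 1) :
    D (formalLog F) * F = D F := by
  have ha : constantCoeff (F - 1) = 0 := by simp [hF]
  have hs : PowerSeries.HasSubst (F - 1) := PowerSeries.HasSubst.of_constantCoeff_zero ha
  have h1 : PowerSeries.derivative K (PowerSeries.log K) * (1 + PowerSeries.X) = 1 := by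
    rw [PowerSeries.deriv_log]
    ext n
    cases n with
    | zero => simp
    | succ n => simp [mul_add, PowerSeries.coeff_succ_mul_X, pow_succ, PowerSeries.coeff_one]
  have h2 := congrArg (PowerSeries.substAlgHom (R := K) hs) h1
  simp only [map_mul, map_add, map_one, PowerSeries.substAlgHom_X] at h2
  rw [PowerSeries.coe_substAlgHom hs, add_sub_cancel] at h2
  rw [formalLog, derivation_subst D ha, mul_right_comm, h2, one_mul, map_sub,
    Derivation.map_one_eq_zero, sub_zero]

theorem X_dvd_formalLog {F : MvPowerSeries (Fin 2) K} {s : Fin 2}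
    (hF : MvPowerSeries.X s ∣ F - 1) : MvPowerSeries.X s ∣ formalLog F := by
  obtain ⟨g, hg⟩ : (PowerSeries.X : PowerSeries K) ∣ PowerSeries.log K :=
    PowerSeries.X_dvd_iff.2 PowerSeries.constantCoeff_log
  have hs : PowerSeries.HasSubst (F - 1) := by
    apply PowerSeries.HasSubst.of_constantCoeff_zero
    obtain ⟨h, hh⟩ := hF
    simp [hh]
  rw [formalLog, hg, PowerSeries.subst_mul hs, PowerSeries.subst_X hs]
  exact hF.mul_right _

end Log

/-! ### Excess of `t`-degree over `z`-degree -/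

section Growth

variable {K : Type*} [CommRing K]

/-- In the part of `f` of `z`-degree less than `J`, the `t`-degree exceeds the `z`-degree by at
most `r`. -/
def ExcessLE (r J : ℕ) (f : MvPowerSeries (Fin 2) K) : Prop :=
  ∀ d : Fin 2 →₀ ℕ, d 1 < J → d 1 + r < d 0 → coeff d f = 0

theorem ExcessLE.mono {r s J : ℕ} {f : MvPowerSeries (Fin 2) K} (hf : ExcessLE r J f)
    (h : r ≤ s) : ExcessLE s J f :=
  fun d hd hd' ↦ hf d hd (by omega)

theorem ExcessLE.add {r J : ℕ} {f g : MvPowerSeries (Fin 2) K} (hf : ExcessLE r J f)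
    (hg : ExcessLE r J g) : ExcessLE r J (f + g) :=
  fun d hd hd' ↦ by rw [map_add, hf d hd hd', hg d hd hd', add_zero]

theorem ExcessLE.mul {r s J : ℕ} {f g : MvPowerSeries (Fin 2) K} (hf : ExcessLE r J f)
    (hg : ExcessLE s J g) : ExcessLE (r + s) J (f * g) := by
  classical
  intro d hd hd'
  rw [MvPowerSeries.coeff_mul]
  refine Finset.sum_eq_zero fun p hp ↦ ?_
  have h := Finset.HasAntidiagonal.mem_antidiagonal.1 hp
  have h0 : p.1 0 + p.2 0 = d 0 := by rw [← h]; rfl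
  have h1 : p.1 1 + p.2 1 = d 1 := by rw [← h]; rfl
  by_cases h' : p.1 1 + r < p.1 0
  · rw [hf _ (by omega) h', zero_mul]
  · rw [hg _ (by omega) (by omega), mul_zero]

theorem ExcessLE.euler {r J : ℕ} {f : MvPowerSeries (Fin 2) K} (hf : ExcessLE r J f)
    (s : Fin 2) : ExcessLE r J (euler s f) :=
  fun d hd hd' ↦ by rw [coeff_euler, hf d hd hd', mul_zero]

theorem excessLE_one (J : ℕ) : ExcessLE 0 J (1 : MvPowerSeries (Fin 2) K) := by
  classical
  intro d _ hd
  rw [MvPowerSeries.coeff_one, if_neg]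
  rintro rfl
  simp at hd

/-- The series `e^{-L} (t ∂ / ∂ t)ʳ e^L`. -/
def conjEuler (L : MvPowerSeries (Fin 2) K) : ℕ → MvPowerSeries (Fin 2) K
  | 0 => 1
  | r + 1 => euler 0 (conjEuler L r) + euler 0 L * conjEuler L r

theorem excessLE_conjEuler {J : ℕ} {L : MvPowerSeries (Fin 2) K} (hL : ExcessLE 1 J L) (r : ℕ) :
    ExcessLE r J (conjEuler L r) := by
  induction r with
  | zero => exact excessLE_one J
  | succ r ih =>
    refine ((ih.euler 0).mono r.le_succ).add ?_
    rw [Nat.succ_eq_add_one, add_comm]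
    exact (hL.euler 0).mul ih

/-- The recursion of `conjEuler` is the product rule applied to `P_r * F`, with `θ_t F = (θ_t L) F`.
-/
theorem iterate_euler_eq_conjEuler_mul {F L : MvPowerSeries (Fin 2) K}
    (h : euler 0 L * F = euler 0 F) (r : ℕ) : (euler 0)^[r] F = conjEuler L r * F := by
  induction r with
  | zero => simp [conjEuler]
  | succ r ih =>
    rw [Function.iterate_succ_apply', ih, Derivation.leibniz, conjEuler, smul_eq_mul, smul_eq_mul,
      ← h]
    ring

theorem coeff_X_pow_mul_eq_ite {σ : Type*} (s : σ) (p : ℕ) (f : MvPowerSeries σ K) (d : σ →₀ ℕ) :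
    coeff d (MvPowerSeries.X s ^ p * f)
      = if p ≤ d s then coeff (d - Finsupp.single s p) f else 0 := by
  classical
  rw [MvPowerSeries.X_pow_eq, MvPowerSeries.coeff_monomial_mul]
  simp [Finsupp.single_le_iff]

/-- The part of degree at most `J` in the weights of `∑ (m + n) c_{mn} z^{m+n} P_{m+1}`. -/
def truncatedFlow (c : ℕ → ℕ → K) (P : ℕ → MvPowerSeries (Fin 2) K) (J : ℕ) :
    MvPowerSeries (Fin 2) K :=
  ∑ p ∈ Finset.range (J + 1), ∑ x ∈ Finset.HasAntidiagonal.antidiagonal p,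
    MvPowerSeries.C ((p : K) * c x.1 x.2) * (MvPowerSeries.X 1 ^ p * P (x.1 + 1))

theorem coeff_truncatedFlow (c : ℕ → ℕ → K) (P : ℕ → MvPowerSeries (Fin 2) K) {J : ℕ}
    {d : Fin 2 →₀ ℕ} (hd : d 1 ≤ J) :
    coeff d (truncatedFlow c P J) = ∑ p ∈ Finset.range (d 1 + 1), ∑ x ∈ Finset.HasAntidiagonal.antidiagonal p,
      (p : K) * c x.1 x.2 * coeff (d - Finsupp.single 1 p) (P (x.1 + 1)) := by
  simp only [truncatedFlow, map_sum, MvPowerSeries.coeff_C_mul, coeff_X_pow_mul_eq_ite]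
  symm
  apply Finset.sum_subset_zero_on_sdiff
  · intro p hp
    simp only [Finset.mem_range] at *
    omega
  · intro p hp
    simp only [Finset.mem_sdiff, Finset.mem_range] at hp
    refine Finset.sum_eq_zero fun x _ ↦ ?_
    rw [if_neg (by omega), mul_zero]
  · intro p hp
    refine Finset.sum_congr rfl fun x _ ↦ ?_
    rw [if_pos (by simpa [Nat.lt_succ_iff] using hp)]

theorem truncatedFlow_mul (c : ℕ → ℕ → K) (P : ℕ → MvPowerSeries (Fin 2) K) (J : ℕ)
    (F : MvPowerSeries (Fin 2) K) :
    truncatedFlow c P J * F = truncatedFlow c (fun r ↦ P r * F) J := by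
  simp only [truncatedFlow, Finset.sum_mul, mul_assoc]

/-- This is where the induction gains a degree. The factor `p` kills `p = 0`; for `p ≥ 1`, `P (m +
1)` is read at `z`-degree `J - p < J`, so its `t`-degree is at most `(J - p) + (m + 1) ≤ J + 1`,
because `m ≤ p`. -/
theorem coeff_truncatedFlow_eq_zero (c : ℕ → ℕ → K) {P : ℕ → MvPowerSeries (Fin 2) K} {J : ℕ}
    (hP : ∀ r, ExcessLE r J (P r)) {d : Fin 2 →₀ ℕ} (hd : d 1 = J) (hd' : d 1 + 1 < d 0) :
    coeff d (truncatedFlow c P J) = 0 := by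
  rw [coeff_truncatedFlow c P hd.le]
  refine Finset.sum_eq_zero fun p hp ↦ Finset.sum_eq_zero fun x hx ↦ ?_
  rw [Finset.mem_range] at hp
  rw [Finset.HasAntidiagonal.mem_antidiagonal] at hx
  rcases Nat.eq_zero_or_pos p with rfl | hp0
  · simp
  · rw [hP _ _ _ _, mul_zero]
    · simp; omega
    · simp; omega

end Growth

/-! ### The induction on the `z`-degree -/

section Main

variable {K : Type*} [CommRing K] [Algebra ℚ K]

theorem coeff_expGenFun (A : ℕ → PowerSeries K) (d : Fin 2 →₀ ℕ) :
    coeff d (expGenFun A) = (1 / ((d 0)! : ℚ)) • PowerSeries.coeff (d 1) (A (d 0)) := rfl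

theorem eq_zero_of_natCast_mul {n : ℕ} (hn : n ≠ 0) {x : K} (h : (n : K) * x = 0) : x = 0 := by
  have h2 : (n : ℚ) • x = 0 := by rw [Nat.cast_smul_eq_nsmul, nsmul_eq_mul, h]
  rw [← one_smul ℚ x, ← inv_mul_cancel₀ (Nat.cast_ne_zero.2 hn : (n : ℚ) ≠ 0), mul_smul, h2,
    smul_zero]

/-- Modulo `z`, the generating function is `e^{wt}`, characterised here by its differential
equation. -/
theorem X_one_dvd_euler_expGenFun {A : ℕ → PowerSeries K} {w : K}
    (hw : ∀ k, PowerSeries.constantCoeff (A k) = w ^ k) :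
    MvPowerSeries.X 1 ∣ euler 0 (expGenFun A)
      - MvPowerSeries.C w * (MvPowerSeries.X 0 ^ 1 * expGenFun A) := by
  rw [MvPowerSeries.X_dvd_iff]
  intro d hd
  rw [map_sub, coeff_euler, MvPowerSeries.coeff_C_mul, coeff_X_pow_mul_eq_ite]
  simp only [coeff_expGenFun, Finsupp.tsub_apply, hd, PowerSeries.coeff_zero_eq_constantCoeff_apply,
    hw]
  split_ifs with h
  · obtain ⟨k, hk⟩ := Nat.exists_eq_add_of_le' h
    simp only [hk]
    have : ((k + 1 : ℕ) : K) * (1 / ((k + 1)! : ℚ)) • w ^ (k + 1) = (1 / (k ! : ℚ)) • w ^ (k + 1) := by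
      rw [← nsmul_eq_mul, ← Nat.cast_smul_eq_nsmul ℚ, smul_smul, Nat.factorial_succ]
      congr 1
      push_cast
      field_simp
    rw [this]
    simp [hw, pow_succ']
  · have : d 0 = 0 := by omega
    simp [this]

/-- Vanishing of the coefficients of the logarithm, for any family `A` whose logarithmic
derivatives are those of `k ↦ ∑ c_{mn} k^{m+1} z^{m+n}`. -/
theorem excessLE_formalLog {A : ℕ → PowerSeries K} {w : K} {c : ℕ → ℕ → K}
    (hw : ∀ k, PowerSeries.constantCoeff (A k) = w ^ k)
    (hA : ∀ k j : ℕ, (j : K) * PowerSeries.coeff j (A k) = ∑ p ∈ Finset.range (j + 1),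
      ((p : K) * ∑ x ∈ Finset.HasAntidiagonal.antidiagonal p, c x.1 x.2 * (k : K) ^ (x.1 + 1))
        * PowerSeries.coeff (j - p) (A k)) (J : ℕ) :
    ExcessLE 1 J (formalLog (expGenFun A)) := by
  set F := expGenFun A with hF
  set L := formalLog F with hL
  have hF1 : constantCoeff F = 1 := by
    rw [← MvPowerSeries.coeff_zero_eq_constantCoeff_apply, hF, coeff_expGenFun]
    simp [hw]
  have hu : IsUnit F := by rw [MvPowerSeries.isUnit_iff_constantCoeff, hF1]; exact isUnit_one
  have hD : euler 0 L * F = euler 0 F := derivation_formalLog_mul _ hF1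
  have hE : euler 1 L * F = euler 1 F := derivation_formalLog_mul _ hF1
  induction J with
  | zero => intro d hd; omega
  | succ J ih =>
    intro d hd hd'
    rcases Nat.lt_succ_iff_lt_or_eq.1 hd with hlt | hJ
    · exact ih d hlt hd'
    rcases Nat.eq_zero_or_pos J with rfl | hpos
    -- Cancelling the unit `F` leaves `θ_t L ≡ w t` modulo `z`, so no power of `t` above the first
    -- survives.
    · have h := X_one_dvd_euler_expGenFun hw
      rw [← hF, ← hD, ← mul_assoc, ← sub_mul, hu.dvd_mul_right, MvPowerSeries.X_dvd_iff] at h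
      have h' := h d hJ
      rw [map_sub, coeff_euler, ← mul_one (MvPowerSeries.X 0 ^ 1), MvPowerSeries.coeff_C_mul,
        coeff_X_pow_mul_eq_ite, if_pos (by omega), excessLE_one 1 _ (by simp [hJ])
        (by simp; omega), mul_zero, sub_zero] at h'
      exact eq_zero_of_natCast_mul (by omega) h'
    -- The equation for `θ_z L` is needed only modulo `z^(J+1)`, where the sum is finite; it is
    -- checked after multiplication by the unit `F`.
    · have h : (MvPowerSeries.X 1 : MvPowerSeries (Fin 2) K) ^ (J + 1)
          ∣ (euler 1 L - truncatedFlow c (conjEuler L) J) * F := by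
        rw [MvPowerSeries.X_pow_dvd_iff]
        intro e he
        rw [sub_mul, truncatedFlow_mul, hE, map_sub, sub_eq_zero, coeff_euler,
          coeff_truncatedFlow _ _ (Nat.lt_succ_iff.1 he)]
        simp only [← iterate_euler_eq_conjEuler_mul hD, coeff_iterate_euler]
        simp only [hF, coeff_expGenFun, mul_smul_comm, hA, Finset.smul_sum]
        refine Finset.sum_congr rfl fun p _ ↦ ?_
        rw [← Finset.smul_sum]
        congr 1
        · simp
        rw [Finset.mul_sum, Finset.sum_mul]
        refine Finset.sum_congr rfl fun x _ ↦ ?_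
        simp [mul_assoc]
      rw [hu.dvd_mul_right, MvPowerSeries.X_pow_dvd_iff] at h
      have h' := h d (by omega)
      rw [map_sub, coeff_euler, coeff_truncatedFlow_eq_zero c (excessLE_conjEuler ih) hJ hd',
        sub_zero] at h'
      exact eq_zero_of_natCast_mul (by omega) h'

end Main

/-! ### Series of the form `t Ψ(tz, z)` -/

section Psi

variable {K : Type*} [CommRing K]

theorem coeff_subst_X_mul_X (Ψ : MvPowerSeries (Fin 2) K) (e : Fin 2 →₀ ℕ) :
    coeff e (MvPowerSeries.subst (![MvPowerSeries.X 0 * MvPowerSeries.X 1, MvPowerSeries.X 1] :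
      Fin 2 → MvPowerSeries (Fin 2) K) Ψ) =
      if e 0 ≤ e 1 then coeff (Finsupp.single 0 (e 0) + Finsupp.single 1 (e 1 - e 0)) Ψ else 0 := by
  classical
  have hprod : ∀ m : Fin 2 →₀ ℕ, coeff e (m.prod fun s k ↦
      (![MvPowerSeries.X 0 * MvPowerSeries.X 1, MvPowerSeries.X 1] :
        Fin 2 → MvPowerSeries (Fin 2) K) s ^ k) = if e 0 = m 0 ∧ e 1 = m 0 + m 1 then 1 else 0 := by
    intro m
    rw [Finsupp.prod_fintype _ _ (by simp), Fin.prod_univ_two]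
    simp only [Matrix.cons_val_zero, Matrix.cons_val_one]
    rw [mul_pow, mul_assoc, ← pow_add, MvPowerSeries.X_pow_eq, MvPowerSeries.X_pow_eq,
      MvPowerSeries.monomial_mul_monomial, MvPowerSeries.coeff_monomial, one_mul]
    congr 1
    simp [Finsupp.ext_iff, Fin.forall_fin_two]
  rw [MvPowerSeries.coeff_subst (MvPowerSeries.hasSubst_of_constantCoeff_zero
    (by simp [Fin.forall_fin_two]))]
  simp only [hprod]
  split_ifs with h
  · rw [finsum_eq_single _ (Finsupp.single 0 (e 0) + Finsupp.single 1 (e 1 - e 0))]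
    · simp [h]
    · intro m hm
      rw [if_neg, smul_zero]
      rintro ⟨h0, h1⟩
      apply hm
      ext i
      fin_cases i
      · simp [h0]
      · simp [h0, h1]
  · apply finsum_eq_zero_of_forall_eq_zero
    intro m
    rw [if_neg (by omega), smul_zero]

theorem coeff_tPsi (Ψ : MvPowerSeries (Fin 2) K) (d : Fin 2 →₀ ℕ) :
    coeff d (tPsi Ψ) = if 1 ≤ d 0 ∧ d 0 ≤ d 1 + 1 then
      coeff (Finsupp.single 0 (d 0 - 1) + Finsupp.single 1 (d 1 + 1 - d 0)) Ψ else 0 := by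
  have h : tPsi Ψ = MvPowerSeries.X 0 ^ 1 * MvPowerSeries.subst
      (![MvPowerSeries.X 0 * MvPowerSeries.X 1, MvPowerSeries.X 1] :
        Fin 2 → MvPowerSeries (Fin 2) K) Ψ := by rw [pow_one]; rfl
  rw [h, coeff_X_pow_mul_eq_ite, coeff_subst_X_mul_X]
  have h0 : (d - Finsupp.single 0 1 : Fin 2 →₀ ℕ) 0 = d 0 - 1 := by simp
  have h1 : (d - Finsupp.single 0 1 : Fin 2 →₀ ℕ) 1 = d 1 := by simp
  rw [h0, h1, ← ite_and]
  by_cases h2 : 1 ≤ d 0 ∧ d 0 ≤ d 1 + 1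
  · rw [if_pos h2, if_pos ⟨h2.1, by omega⟩]
    congr 4
    omega
  · rw [if_neg h2, if_neg (by omega)]

theorem exists_eq_tPsi {F : MvPowerSeries (Fin 2) K} (hX : MvPowerSeries.X 0 ∣ F)
    (hF : ∀ J, ExcessLE 1 J F) : ∃ Ψ, F = tPsi Ψ := by
  -- The monomial `u^m v^n` of `Ψ` contributes exactly `t^(m+1) z^(m+n)`.
  let Ψ : MvPowerSeries (Fin 2) K := fun d ↦
    coeff (Finsupp.single 0 (d 0 + 1) + Finsupp.single 1 (d 0 + d 1)) F
  have hΨ : ∀ d, coeff d Ψ =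
      coeff (Finsupp.single 0 (d 0 + 1) + Finsupp.single 1 (d 0 + d 1)) F := fun _ ↦ rfl
  refine ⟨Ψ, MvPowerSeries.ext fun d ↦ ?_⟩
  rw [coeff_tPsi]
  split_ifs with h
  · rw [hΨ]
    refine congrArg (fun e ↦ coeff e F) (Finsupp.ext fun i ↦ ?_)
    fin_cases i
    · simp; omega
    · simp; omega
  · by_cases h0 : d 0 = 0
    · exact MvPowerSeries.X_dvd_iff.1 hX d h0
    · exact hF (d 1 + 1) d (by omega) (by omega)

end Psi

/-! ### Coefficients of `k Φ(kz, z)` and logarithmic derivatives -/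

section Exponent

variable {K : Type*} [CommRing K]

theorem coeff_exponent (Φ : MvPowerSeries (Fin 2) K) (k j : ℕ) :
    PowerSeries.coeff j (exponent Φ k) = ∑ x ∈ Finset.HasAntidiagonal.antidiagonal j,
      coeff (Finsupp.single 0 x.1 + Finsupp.single 1 x.2) Φ * (k : K) ^ (x.1 + 1) := by
  classical
  have hprod : ∀ m : Fin 2 →₀ ℕ, PowerSeries.coeff j (m.prod fun s i ↦
      (![(k : K) • PowerSeries.X, PowerSeries.X] : Fin 2 → PowerSeries K) s ^ i)
        = if m 0 + m 1 = j then (k : K) ^ m 0 else 0 := by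
    intro m
    rw [Finsupp.prod_fintype _ _ (by simp), Fin.prod_univ_two]
    simp only [Matrix.cons_val_zero, Matrix.cons_val_one]
    rw [smul_pow, smul_mul_assoc, ← pow_add, PowerSeries.coeff_smul, PowerSeries.coeff_X_pow]
    simp [eq_comm]
  have hs : MvPowerSeries.HasSubst
      (![(k : K) • PowerSeries.X, PowerSeries.X] : Fin 2 → PowerSeries K) :=
    MvPowerSeries.hasSubst_of_constantCoeff_zero (by
      rw [Fin.forall_fin_two]
      exact ⟨by simp [PowerSeries.X], by simp [PowerSeries.X]⟩)
  have h : PowerSeries.coeff j (MvPowerSeries.subst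
      (![(k : K) • PowerSeries.X, PowerSeries.X] : Fin 2 → PowerSeries K) Φ : PowerSeries K) =
      ∑ᶠ m : Fin 2 →₀ ℕ, coeff m Φ • PowerSeries.coeff j (m.prod fun s i ↦
      (![(k : K) • PowerSeries.X, PowerSeries.X] : Fin 2 → PowerSeries K) s ^ i) :=
    MvPowerSeries.coeff_subst hs Φ _
  rw [exponent, PowerSeries.coeff_smul, h]
  simp only [hprod]
  let g : ℕ × ℕ → (Fin 2 →₀ ℕ) := fun x ↦ Finsupp.single 0 x.1 + Finsupp.single 1 x.2
  have hg : Function.Injective g := by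
    intro x y hxy
    have h0 := DFunLike.congr_fun hxy 0
    have h1 := DFunLike.congr_fun hxy 1
    simp [g] at h0 h1
    exact Prod.ext h0 h1
  rw [finsum_eq_sum_of_support_subset (s := (Finset.HasAntidiagonal.antidiagonal j).image g),
    Finset.sum_image hg.injOn, Finset.smul_sum]
  · refine Finset.sum_congr rfl fun x hx ↦ ?_
    rw [Finset.HasAntidiagonal.mem_antidiagonal] at hx
    simp [g, hx, pow_succ]
    ring
  · intro m hm
    rw [Finset.coe_image]
    refine ⟨(m 0, m 1), ?_, ?_⟩
    · by_contra h'
      apply hm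
      rw [Finset.mem_coe, Finset.HasAntidiagonal.mem_antidiagonal] at h'
      simp only at h'
      simp [h']
    · ext i
      fin_cases i <;> simp [g]

theorem constantCoeff_exponent (Φ : MvPowerSeries (Fin 2) K) (k : ℕ) :
    PowerSeries.constantCoeff (exponent Φ k) = k * constantCoeff Φ := by
  rw [← PowerSeries.coeff_zero_eq_constantCoeff_apply, coeff_exponent]
  simp [mul_comm]

theorem natCast_mul_coeff_of_derivative_eq {f A : PowerSeries K}
    (h : PowerSeries.derivative K A = PowerSeries.derivative K f * A) (j : ℕ) :
    (j : K) * PowerSeries.coeff j A = ∑ p ∈ Finset.range (j + 1),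
      ((p : K) * PowerSeries.coeff p f) * PowerSeries.coeff (j - p) A := by
  cases j with
  | zero => simp
  | succ j =>
    have h' := congrArg (PowerSeries.coeff j) h
    rw [PowerSeries.coeff_derivative, PowerSeries.coeff_mul,
      Finset.Nat.sum_antidiagonal_eq_sum_range_succ
        (fun a b ↦ PowerSeries.coeff a (PowerSeries.derivative K f) * PowerSeries.coeff b A)] at h'
    rw [Finset.sum_range_succ']
    simp only [Nat.cast_zero, zero_mul, add_zero, Nat.add_sub_add_right]
    rw [mul_comm, Nat.cast_succ, h']
    refine Finset.sum_congr rfl fun p _ ↦ ?_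
    rw [PowerSeries.coeff_derivative, Nat.cast_succ]
    ring

end Exponent

/-! ### The exponential and the common form of both cases -/

section Exp

variable {K : Type*} [CommRing K] [Algebra ℚ K]

theorem derivative_formalExp {f : PowerSeries K} (hf : PowerSeries.constantCoeff f = 0) :
    PowerSeries.derivative K (formalExp f) = PowerSeries.derivative K f * formalExp f := by
  rw [formalExp, PowerSeries.derivative_subst (PowerSeries.HasSubst.of_constantCoeff_zero' hf),
    PowerSeries.derivative_exp, mul_comm]

theorem constantCoeff_formalExp {f : PowerSeries K} (hf : PowerSeries.constantCoeff f = 0) :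
    PowerSeries.constantCoeff (formalExp f) = 1 := by
  have hs := PowerSeries.HasSubst.of_constantCoeff_zero' hf
  rw [formalExp, ← PowerSeries.coeff_zero_eq_constantCoeff_apply, PowerSeries.coeff_subst' hs,
    finsum_eq_single _ 0]
  · simp
  · intro n hn
    simp [hf, hn]

theorem formalExp_zero : formalExp (0 : PowerSeries K) = 1 := by
  have h := PowerSeries.subst_zero_eq_C_constantCoeff (τ := Unit) (S := K) (f := PowerSeries.exp K)
  rw [PowerSeries.constantCoeff_exp] at h
  exact h.trans (by simp)

/-- Both exponentials enter only through these three properties; a constant factor such as `e^a`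
does not affect the logarithmic derivative. `A 0 = 1` makes `L` divisible by `t`. -/
theorem logarithm_form {A : ℕ → PowerSeries K} {w : K} (Φ : MvPowerSeries (Fin 2) K)
    (h0 : A 0 = 1) (hw : ∀ k, PowerSeries.constantCoeff (A k) = w ^ k)
    (hA : ∀ k, PowerSeries.derivative K (A k) = PowerSeries.derivative K (exponent Φ k) * A k) :
    (∃ Ψ : MvPowerSeries (Fin 2) K, formalLog (expGenFun A) = tPsi Ψ) ∧
      (∀ j : ℕ, coeffTZ 0 j (formalLog (expGenFun A)) = 0) ∧
      (∀ n j : ℕ, j < n → coeffTZ (n + 1) j (formalLog (expGenFun A)) = 0) := by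
  classical
  have hX : MvPowerSeries.X 0 ∣ formalLog (expGenFun A) := by
    apply X_dvd_formalLog
    rw [MvPowerSeries.X_dvd_iff]
    intro d hd
    rw [map_sub, coeff_expGenFun, hd, h0, MvPowerSeries.coeff_one, PowerSeries.coeff_one]
    simp [Finsupp.ext_iff, Fin.forall_fin_two, hd]
  have hL : ∀ J, ExcessLE 1 J (formalLog (expGenFun A)) :=
    excessLE_formalLog (c := fun m n ↦ coeff (Finsupp.single 0 m + Finsupp.single 1 n) Φ) hw
      fun k j ↦ by
        rw [natCast_mul_coeff_of_derivative_eq (hA k)]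
        simp only [coeff_exponent]
  refine ⟨exists_eq_tPsi hX hL, fun j ↦ ?_, fun n j hj ↦ ?_⟩
  · exact MvPowerSeries.X_dvd_iff.1 hX _ (by simp)
  · exact hL (j + 1) _ (by simp) (by simpa using hj)

end Exp

end

end BouwkampDeBruijn

open BouwkampDeBruijn
theorem mainTheorem1 :
    -- coefficients in a complete normed commutative algebra (such as `ℝ` or `ℂ`), any `Φ`
    (∀ (K : Type*) [NormedCommRing K] [NormedAlgebra ℚ K] [CompleteSpace K]
        (Φ : MvPowerSeries (Fin 2) K),
      (∃ Ψ : MvPowerSeries (Fin 2) K,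
        formalLog (expGenFun fun k ↦ analyticExp (exponent Φ k)) = tPsi Ψ) ∧
      (∀ j : ℕ, coeffTZ 0 j
        (formalLog (expGenFun fun k ↦ analyticExp (exponent Φ k))) = 0) ∧
      (∀ n j : ℕ, j < n → coeffTZ (n + 1) j
        (formalLog (expGenFun fun k ↦ analyticExp (exponent Φ k))) = 0)) ∧
    -- coefficients in an arbitrary commutative `ℚ`-algebra, `Φ(0, 0) = 0`
    (∀ (K : Type*) [CommRing K] [Algebra ℚ K] (Φ : MvPowerSeries (Fin 2) K),
      MvPowerSeries.constantCoeff Φ = 0 →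
      (∃ Ψ : MvPowerSeries (Fin 2) K,
        formalLog (expGenFun fun k ↦ formalExp (exponent Φ k)) = tPsi Ψ) ∧
      (∀ j : ℕ, coeffTZ 0 j
        (formalLog (expGenFun fun k ↦ formalExp (exponent Φ k))) = 0) ∧
      (∀ n j : ℕ, j < n → coeffTZ (n + 1) j
        (formalLog (expGenFun fun k ↦ formalExp (exponent Φ k))) = 0)) := by
  constructor
  · intro K _ _ _ Φ
    -- The constant term of `k Φ(kz, z)` is `k c₀₀`, and `e^(k c₀₀) = (e^c₀₀)^k`.
    refine logarithm_form (w := NormedSpace.exp (MvPowerSeries.constantCoeff Φ)) Φ ?_ ?_ ?_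
    · have h : exponent Φ 0 = 0 := by simp [exponent]
      simp [h, analyticExp, formalExp_zero]
    · intro k
      rw [analyticExp, map_mul, constantCoeff_formalExp (by simp), constantCoeff_exponent,
        PowerSeries.constantCoeff_C, mul_one, ← nsmul_eq_mul, NormedSpace.exp_nsmul]
    · intro k
      rw [analyticExp, Derivation.leibniz, derivative_formalExp (by simp), map_sub,
        PowerSeries.derivative_C, PowerSeries.derivative_C, sub_zero, smul_zero, add_zero,
        smul_eq_mul]
      ring
  · intro K _ _ Φ hΦ
    have hk : ∀ k, PowerSeries.constantCoeff (exponent Φ k) = 0 := fun k ↦ by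
      rw [constantCoeff_exponent, hΦ, mul_zero]
    refine logarithm_form (w := 1) Φ ?_ ?_ fun k ↦ derivative_formalExp (hk k)
    · have h : exponent Φ 0 = 0 := by simp [exponent]
      rw [h, formalExp_zero]
    · intro k
      rw [constantCoeff_formalExp (hk k), one_pow]
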